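/- Graphs are finite, simple and undirected. An ordered graph $(G,<)$ is a graph $G$ together with a linear ordering $<$ of its vertex set. A circuit $v_1,\dots,v_l$ of an ordered graph is \emph{balanced} if, with indices taken modulo $l$, $|\{i : v_i < v_{i+1}\}| = |\{i : v_i > v_{i+1}\}|$, and \emph{unbalanced} otherwise. Let $\mathrm{Bal}_p$ be the class of all ordered graphs that contain no unbalanced circuit of length at most $p$. Theorem. Let $r,p$ be positive integers. For every ordered graph $(G,<)\in \mathrm{Bal}_p$ there is an ordered graph $(H,<)\in \mathrm{Bal}_p$ such that $(H,<)\to(G,<)^2_r$; that is, for every colouring of the edge set of $H$ by $r$ colours there is a (not necessarily induced) subgraph $G'$ of $H$ all of whose edges have the same colour and such that the order-preserving bijection $V(G)\to V(G')$ (with $V(G')$ ordered as in $H$) exists and is a graph isomorphism of $G$ onto $G'$. -/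

import Mathlib

/-- A circuit `v₁, …, v_l` of a graph with linearly ordered vertices, given as a closed walk, is
balanced if it has as many steps going up in the ordering as steps going down. -/
def CircuitBalanced {V : Type*} [LinearOrder V] {G : SimpleGraph V} {v : V}
    (C : G.Walk v v) : Prop :=
  C.darts.countP (fun d => d.fst < d.snd) = C.darts.countP (fun d => d.snd < d.fst)

/-- The class of ordered graphs with no unbalanced circuit of length at most `p`. -/
def MemBal {V : Type*} [LinearOrder V] (p : ℕ) (G : SimpleGraph V) : Prop :=
  ∀ (v : V) (C : G.Walk v v), C.IsCycle → C.length ≤ p → CircuitBalanced C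

/-- Two ordered graphs are isomorphic if an order-preserving bijection of the vertex sets
is a graph isomorphism. -/
def OrderedGraphIso {V W : Type*} [LinearOrder V] [LinearOrder W]
    (G : SimpleGraph V) (H : SimpleGraph W) : Prop :=
  ∃ φ : V ≃o W, ∀ u v : V, G.Adj u v ↔ H.Adj (φ u) (φ v)

/-- `(H,<) → (G,<)²_r`: for every colouring of the edges of `H` by `r` colours there is a
monochromatic subgraph `G'` of `H` which, with the ordering inherited from `H`,
is isomorphic to `G`. -/
def EdgeRamsey {V W : Type*} [LinearOrder V] [LinearOrder W]
    (H : SimpleGraph W) (G : SimpleGraph V) (r : ℕ) : Prop :=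
  ∀ χ : H.edgeSet → Fin r, ∃ G' : H.Subgraph,
    OrderedGraphIso G G'.coe ∧ ∃ c : Fin r, ∀ e : H.edgeSet, (e : Sym2 W) ∈ G'.edgeSet → χ e = c

/-! The argument is a partite construction with induction on `p`. Closed walks are easier to cut and
project than circuits; for lengths at most `p` the two notions of balance agree, since short walks
shrink to paths of equal balance. The case `p = 0` is Ramsey's theorem. Given a Ramsey graph `H`
balanced up to `p`, place disjoint copies of `G` above all its order-preserving homomorphisms to
`H`. This system is balanced up to `p + 1`. For each pair `(a, b)` of vertices of `H`, amalgamate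
copies of the current system along a Hales–Jewett cube, so that in some copy all edges above `(a,
b)` get one colour. Afterwards the colour depends only on the projection, and the Ramsey property of
`H` selects a monochromatic `G`. The crux is `balance_of_closed_of_cut`: amalgamation preserves
balance up to `p + 1` although `H` is balanced only up to `p`. -/

open SimpleGraph

/-! ### Walks with prescribed length and balance -/

/-- The sign of a step from `x` to `y`. -/
def stepSign {W : Type*} [LinearOrder W] (x y : W) : ℤ := if x < y then 1 else -1

theorem stepSign_add_swap {W : Type*} [LinearOrder W] {x y : W} (h : x ≠ y) :
    stepSign x y + stepSign y x = 0 := by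
  rcases lt_or_gt_of_ne h with h | h <;> simp [stepSign, h, h.not_gt]

/-- `SignedReach G f n b u v`: there is a walk of length `n` from `u` to `v` in `G` whose number of
up-steps exceeds its number of down-steps by `b`, heights being measured by `f`. -/
inductive SignedReach {V W : Type*} [LinearOrder W] (G : SimpleGraph V) (f : V → W) :
    ℕ → ℤ → V → V → Prop
  | refl (u : V) : SignedReach G f 0 0 u u
  | step {n : ℕ} {b : ℤ} {u u' v : V} : G.Adj u u' → SignedReach G f n b u' v →
      SignedReach G f (n + 1) (stepSign (f u) (f u') + b) u v

/-- Every closed walk of length at most `p` has balance zero. -/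
def BalancedUpTo {V W : Type*} [LinearOrder W] (p : ℕ) (G : SimpleGraph V) (f : V → W) : Prop :=
  ∀ n ≤ p, ∀ b v, SignedReach G f n b v v → b = 0

namespace SignedReach

variable {V V' W W' : Type*} [LinearOrder W] [LinearOrder W'] {G : SimpleGraph V}
  {G' : SimpleGraph V'} {f : V → W} {f' : V' → W'}

theorem trans {n m : ℕ} {b c : ℤ} {u v w : V} (h : SignedReach G f n b u v)
    (h' : SignedReach G f m c v w) : SignedReach G f (n + m) (b + c) u w := by
  induction h with
  | refl u => simpa using h'
  | step ha _ ih =>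
    have := step (f := f) ha (ih h')
    rwa [← add_assoc, add_right_comm] at this

theorem single {u v : V} (h : G.Adj u v) : SignedReach G f 1 (stepSign (f u) (f v)) u v := by
  simpa using step (f := f) h (refl v)

theorem map (φ : V → V') (hφ : ∀ u v, G.Adj u v → G'.Adj (φ u) (φ v))
    (hs : ∀ u v, G.Adj u v → (f' (φ u) < f' (φ v) ↔ f u < f v))
    {n : ℕ} {b : ℤ} {u v : V} (h : SignedReach G f n b u v) :
    SignedReach G' f' n b (φ u) (φ v) := by
  induction h with
  | refl u => exact refl _
  | @step n b u u' v ha _ ih =>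
    have := step (f := f') (hφ _ _ ha) ih
    have hsg : stepSign (f' (φ u)) (f' (φ u')) = stepSign (f u) (f u') := by
      simp [stepSign, hs _ _ ha]
    rwa [hsg] at this

theorem of_zero {b : ℤ} {u v : V} (h : SignedReach G f 0 b u v) : u = v ∧ b = 0 := by
  cases h; simp

theorem of_one {b : ℤ} {u v : V} (h : SignedReach G f 1 b u v) :
    G.Adj u v ∧ b = stepSign (f u) (f v) := by
  cases h with
  | step ha h =>
    obtain ⟨rfl, rfl⟩ := h.of_zero
    simp [ha]

end SignedReach

/-! ### Comparison with circuits -/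

/-- Up-steps minus down-steps of a walk. -/
def walkBalance {V : Type*} [LinearOrder V] {G : SimpleGraph V} {u v : V} (C : G.Walk u v) : ℤ :=
  (C.darts.countP (fun d => d.fst < d.snd) : ℤ) - C.darts.countP (fun d => d.snd < d.fst)

section Walks

variable {V : Type*} [LinearOrder V] {G : SimpleGraph V}

theorem walkBalance_cons {u v w : V} (h : G.Adj u v) (C : G.Walk v w) :
    walkBalance (Walk.cons h C) = stepSign u v + walkBalance C := by
  rcases lt_or_gt_of_ne h.ne with h' | h' <;>
    simp [walkBalance, stepSign, h', h'.not_gt] <;> ring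

theorem walkBalance_append {u v w : V} (C : G.Walk u v) (D : G.Walk v w) :
    walkBalance (C.append D) = walkBalance C + walkBalance D := by
  simp only [walkBalance, Walk.darts_append, List.countP_append]
  push_cast
  ring

theorem circuitBalanced_iff {v : V} (C : G.Walk v v) : CircuitBalanced C ↔ walkBalance C = 0 := by
  rw [CircuitBalanced, walkBalance]
  omega

theorem signedReach_of_walk {u v : V} (C : G.Walk u v) :
    SignedReach G id C.length (walkBalance C) u v := by
  induction C with
  | nil => exact SignedReach.refl _
  | cons h C ih =>
    rw [walkBalance_cons]
    exact SignedReach.step (f := id) h ih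

theorem BalancedUpTo.memBal {p : ℕ} (h : BalancedUpTo p G id) : MemBal p G :=
  fun v C _ hl => (circuitBalanced_iff C).2 (h _ hl _ v (signedReach_of_walk C))

theorem walkBalance_of_path_of_mem_edges {u v : V} (h : G.Adj u v) (q : G.Walk v u)
    (hq : q.IsPath) (he : s(u, v) ∈ q.edges) : walkBalance q = stepSign v u := by
  cases q with
  | nil => simp at he
  | @cons _ x _ h' q =>
    rw [Walk.cons_isPath_iff] at hq
    rw [Walk.edges_cons, List.mem_cons] at he
    rcases he with he | he
    · have hx : u = x := by
        rw [Sym2.eq_iff] at he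
        rcases he with ⟨h1, -⟩ | ⟨h1, -⟩
        · exact absurd h1 h.ne
        · exact h1
      subst hx
      obtain rfl := (Walk.isPath_iff_nil.1 hq.1).eq_nil
      rw [walkBalance_cons]
      simp [walkBalance]
    · exact absurd (Walk.snd_mem_support_of_mem_edges q he) hq.2

/-- When a new first vertex already lies on the path, the loop it closes is either a backtracked
edge or a circuit of length at most `p`; it has balance zero and can be dropped. -/
theorem SignedReach.exists_path {p : ℕ} (hG : MemBal p G) {n : ℕ} {b : ℤ} {u v : V}
    (h : SignedReach G id n b u v) (hn : n ≤ p) :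
    ∃ q : G.Walk u v, q.IsPath ∧ q.length ≤ n ∧ walkBalance q = b := by
  induction h with
  | refl u => exact ⟨Walk.nil, by simp, by simp, by simp [walkBalance]⟩
  | @step n b u u' v ha _ ih =>
    obtain ⟨q, hq, hl, hb⟩ := ih (by omega)
    by_cases hu : u ∈ q.support
    · have hspec := Walk.take_spec q hu
      have hlen := congrArg Walk.length hspec
      rw [Walk.length_append] at hlen
      refine ⟨q.dropUntil u hu, hq.dropUntil hu, by omega, ?_⟩
      have h1 : stepSign u u' + walkBalance (q.takeUntil u hu) = 0 := by
        by_cases he : s(u, u') ∈ (q.takeUntil u hu).edges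
        · rw [walkBalance_of_path_of_mem_edges ha _ (hq.takeUntil hu) he]
          exact stepSign_add_swap ha.ne
        · rw [← walkBalance_cons ha, ← circuitBalanced_iff]
          refine hG _ _ ((Walk.cons_isCycle_iff _ _).2 ⟨hq.takeUntil hu, he⟩) ?_
          rw [Walk.length_cons]
          omega
      rw [← hspec, walkBalance_append] at hb
      simp only [id]
      linarith
    · refine ⟨Walk.cons ha q, hq.cons hu, by simpa using hl, ?_⟩
      rw [walkBalance_cons, hb]
      rfl

theorem MemBal.balancedUpTo {p : ℕ} (hG : MemBal p G) : BalancedUpTo p G id := by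
  intro n hn b v h
  obtain ⟨q, hq, -, hb⟩ := h.exists_path hG hn
  obtain rfl := (Walk.isPath_iff_nil.1 hq).eq_nil
  simpa [walkBalance] using hb.symm

end Walks

/-! ### The amalgam of copies over the edges above a fixed pair -/

section Amalgam

variable {X W ι : Type*} [LinearOrder W]

/-- The copy, indexed by the word `l`, of `X` in the amalgam. Vertices above `a` and `b` are sent to
points of the combinatorial line of `l`; the other vertices are labelled by `l`. -/
def copyMap (π : X → W) (a b : W) (l : ι → Option (X × X)) (x : X) :
    W × Option (ι → Option (X × X)) × (ι → X) :=
  if π x = a then (a, none, fun i => (l i).elim x Prod.fst)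
  else if π x = b then (b, none, fun i => (l i).elim x Prod.snd)
  else (π x, some l, fun _ => x)

/-- Words with a moving coordinate whose constant letters are edges. -/
def IsEdgeLine (P : SimpleGraph X) (l : ι → Option (X × X)) : Prop :=
  (∃ i, l i = none) ∧ ∀ i e, l i = some e → P.Adj e.1 e.2

variable {P : SimpleGraph X} {H : SimpleGraph W} {π : X → W} {a b : W}
  {l l' : ι → Option (X × X)}

theorem copyMap_fst (x : X) : (copyMap π a b l x).1 = π x := by
  unfold copyMap
  split_ifs with h1 h2
  · exact h1.symm
  · exact h2.symm
  · rfl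

theorem copyMap_of_left {x : X} (h : π x = a) :
    copyMap π a b l x = (a, none, fun i => (l i).elim x Prod.fst) := by
  simp [copyMap, h]

theorem copyMap_of_right (hab : a ≠ b) {x : X} (h : π x = b) :
    copyMap π a b l x = (b, none, fun i => (l i).elim x Prod.snd) := by
  simp [copyMap, h, hab.symm]

theorem copyMap_injective (hl : IsEdgeLine P l) : Function.Injective (copyMap π a b l) := by
  intro x y h
  have h1 : π x = π y := by rw [← copyMap_fst (π := π) (l := l) (a := a) (b := b) x, h, copyMap_fst]
  obtain ⟨i, hi⟩ := hl.1
  have h2 := congrFun (congrArg (fun z => z.2.2) h) i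
  simp only [copyMap, h1] at h2
  split_ifs at h2 <;> simpa [hi] using h2

theorem eq_of_copyMap_eq (hl : IsEdgeLine P l) {x y : X} (ha : π x ≠ a) (hb : π x ≠ b)
    (h : copyMap π a b l x = copyMap π a b l' y) : l' = l ∧ y = x := by
  have h1 : π x = π y := by
    rw [← copyMap_fst (π := π) (l := l) (a := a) (b := b) x, h, copyMap_fst]
  obtain ⟨i, -⟩ := hl.1
  rw [copyMap, copyMap, if_neg ha, if_neg hb, if_neg (h1 ▸ ha), if_neg (h1 ▸ hb)] at h
  simp only [Prod.mk.injEq, Option.some.injEq] at h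
  exact ⟨h.2.1.symm, (congrFun h.2.2 i).symm⟩

/-- The union of all copies. -/
def amalgam (P : SimpleGraph X) (H : SimpleGraph W) (π : X → W) (a b : W)
    (hπ : ∀ x y, P.Adj x y → H.Adj (π x) (π y)) (ι : Type*) :
    SimpleGraph (W × Option (ι → Option (X × X)) × (ι → X)) where
  Adj u v := ∃ l : ι → Option (X × X), IsEdgeLine P l ∧
    ∃ x y, P.Adj x y ∧ copyMap π a b l x = u ∧ copyMap π a b l y = v
  symm := ⟨fun _ _ ⟨l, hl, x, y, h, hu, hv⟩ => ⟨l, hl, y, x, h.symm, hv, hu⟩⟩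
  loopless := ⟨by
    rintro u ⟨l, hl, x, y, h, hu, hv⟩
    have := hπ _ _ h
    rw [← copyMap_fst (π := π) (l := l) (a := a) (b := b) x, hu, ← hv, copyMap_fst] at this
    exact H.irrefl this⟩

variable {hπ : ∀ x y, P.Adj x y → H.Adj (π x) (π y)}

theorem amalgam_adj_fst {u v} (h : (amalgam P H π a b hπ ι).Adj u v) : H.Adj u.1 v.1 := by
  obtain ⟨l, -, x, y, h, rfl, rfl⟩ := h
  simpa only [copyMap_fst] using hπ _ _ h

/-- At a moving coordinate of `l` the two points read `x` and `y`. In the word producing the edge,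
that coordinate is moving or a constant letter; either way it reads an edge of `P`. -/
theorem adj_of_amalgam_adj (hab : a ≠ b) (hl : IsEdgeLine P l) {x y : X} (hx : π x = a)
    (hy : π y = b) (h : (amalgam P H π a b hπ ι).Adj (copyMap π a b l x) (copyMap π a b l y)) :
    P.Adj x y := by
  obtain ⟨m, hm, x', y', h, hu, hv⟩ := h
  have hx' : π x' = a := by rw [← copyMap_fst (π := π) (l := m) (a := a) (b := b) x', hu, copyMap_fst, hx]
  have hy' : π y' = b := by rw [← copyMap_fst (π := π) (l := m) (a := a) (b := b) y', hv, copyMap_fst, hy]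
  rw [copyMap_of_left hx', copyMap_of_left hx] at hu
  rw [copyMap_of_right hab hy', copyMap_of_right hab hy] at hv
  obtain ⟨i, hi⟩ := hl.1
  have h1 := congrFun (congrArg (fun z => z.2.2) hu) i
  have h2 := congrFun (congrArg (fun z => z.2.2) hv) i
  simp only [hi, Option.elim_none] at h1 h2
  rw [← h1, ← h2]
  cases hmi : m i with
  | none => simpa using h
  | some e => simpa using hm.2 i e hmi

/-- A vertex not above `a` or `b` determines its copy, so a walk can change copies only above `a` or
`b`. -/
theorem lift_or_reach_cut {n : ℕ} {c : ℤ} {u v} (h : SignedReach (amalgam P H π a b hπ ι) Prod.fst n c u v) :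
    ∀ (l : ι → Option (X × X)) (x : X), IsEdgeLine P l → u = copyMap π a b l x →
      π x ≠ a → π x ≠ b →
      (∃ y, v = copyMap π a b l y ∧ SignedReach P π n c x y) ∨
      ∃ y n₁ c₁ n₂ c₂, (π y = a ∨ π y = b) ∧ SignedReach P π n₁ c₁ x y ∧
        SignedReach (amalgam P H π a b hπ ι) Prod.fst n₂ c₂ (copyMap π a b l y) v ∧
        n₁ + n₂ = n ∧ c₁ + c₂ = c ∧ 0 < n₁ := by
  induction h with
  | refl u => exact fun l x hl hu _ _ => Or.inl ⟨x, hu, SignedReach.refl x⟩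
  | @step n c u u' v h hr ih =>
    intro l x hl hu ha hb
    obtain ⟨m, hm, x', y, hxy, hx', hy⟩ := h
    obtain ⟨rfl, rfl⟩ := eq_of_copyMap_eq hl ha hb (hu.symm.trans hx'.symm)
    have hs : stepSign u.1 u'.1 = stepSign (π x') (π y) := by
      rw [hu, ← hy, copyMap_fst, copyMap_fst]
    rw [hs]
    by_cases hc : π y = a ∨ π y = b
    · exact Or.inr ⟨y, 1, _, n, c, hc, SignedReach.single hxy, hy ▸ hr, add_comm _ _, rfl, one_pos⟩
    · push Not at hc
      rcases ih m y hm hy.symm hc.1 hc.2 with ⟨z, hz, hr'⟩ | ⟨z, n₁, c₁, n₂, c₂, hz, h1, h2, h3, h4, h5⟩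
      · exact Or.inl ⟨z, hz, hr'.step hxy⟩
      · exact Or.inr ⟨z, n₁ + 1, _, n₂, c₂, hz, h1.step hxy, h2, by omega, by rw [← h4]; ring,
          by omega⟩

theorem exists_segment {n : ℕ} {c : ℤ} {u v}
    (h : SignedReach (amalgam P H π a b hπ ι) Prod.fst n c u v) (hn : 0 < n)
    (hv : v.1 = a ∨ v.1 = b) :
    ∃ (l : ι → Option (X × X)) (x y : X) (n₁ : ℕ) (c₁ : ℤ) (n₂ : ℕ) (c₂ : ℤ), IsEdgeLine P l ∧
      u = copyMap π a b l x ∧ (π y = a ∨ π y = b) ∧ SignedReach P π n₁ c₁ x y ∧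
        SignedReach (amalgam P H π a b hπ ι) Prod.fst n₂ c₂ (copyMap π a b l y) v ∧
        n₁ + n₂ = n ∧ c₁ + c₂ = c ∧ 0 < n₁ := by
  cases h with
  | refl => simp at hn
  | @step n c _ u' _ h hr =>
    obtain ⟨m, hm, x, y, hxy, rfl, rfl⟩ := h
    rw [copyMap_fst, copyMap_fst]
    by_cases hc : π y = a ∨ π y = b
    · exact ⟨m, x, y, 1, _, n, c, hm, rfl, hc, SignedReach.single hxy, hr, add_comm _ _, rfl,
        one_pos⟩
    · push Not at hc
      rcases lift_or_reach_cut hr m y hm rfl hc.1 hc.2 with ⟨z, rfl, hr'⟩ | ⟨z, n₁, c₁, n₂, c₂, hz, h1, h2, h3, h4, h5⟩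
      · rw [copyMap_fst] at hv
        exact ⟨m, x, z, n + 1, _, 0, 0, hm, rfl, hv, hr'.step hxy, SignedReach.refl _, rfl,
          by ring, by omega⟩
      · exact ⟨m, x, z, n₁ + 1, _, n₂, c₂, hm, rfl, hz, h1.step hxy, h2, by omega,
          by rw [← h4]; ring, by omega⟩

theorem SignedReach.project (hπ : ∀ x y, P.Adj x y → H.Adj (π x) (π y)) {n : ℕ} {c : ℤ} {x y : X}
    (h : SignedReach P π n c x y) : SignedReach H id n c (π x) (π y) :=
  h.map π hπ fun _ _ _ => Iff.rfl

theorem add_eq_zero_of_walks_over_edge {p : ℕ} (hH : BalancedUpTo p H id) {x y : W}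
    (hxy : H.Adj x y) {n m : ℕ} {c d : ℤ} (h : SignedReach H id n c x y)
    (h' : SignedReach H id m d y x) (hn : n + 1 ≤ p) (hm : m + 1 ≤ p) : c + d = 0 := by
  have h1 := hH _ hn _ _ (h.trans (SignedReach.single hxy.symm))
  have h2 := hH _ hm _ _ (h'.trans (SignedReach.single hxy))
  have h3 := stepSign_add_swap hxy.ne
  simp only [id] at h1 h2
  linarith

theorem balance_of_closed_of_cut (hab : H.Adj a b) {p : ℕ} (hH : BalancedUpTo p H id)
    (hP : BalancedUpTo (p + 1) P π) {n : ℕ} (hn : n ≤ p + 1) {c : ℤ} {u}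
    (hu : u.1 = a ∨ u.1 = b)
    (h : SignedReach (amalgam P H π a b hπ ι) Prod.fst n c u u) : c = 0 := by
  have proj : ∀ {n c u v}, SignedReach (amalgam P H π a b hπ ι) Prod.fst n c u v →
      SignedReach H id n c u.1 v.1 :=
    fun h => h.project fun _ _ => amalgam_adj_fst
  rcases Nat.eq_zero_or_pos n with rfl | hpos
  · exact h.of_zero.2
  obtain ⟨l, x, y, n₁, c₁, n₂, c₂, hl, rfl, hy, r₁, r₂, rfl, rfl, hn₁⟩ := exists_segment h hpos hu
  rw [copyMap_fst] at hu
  rcases Nat.eq_zero_or_pos n₂ with rfl | hn₂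
  · obtain ⟨h1, rfl⟩ := r₂.of_zero
    obtain rfl := copyMap_injective hl h1
    simpa using hP _ hn _ _ r₁
  have q₁ := r₁.project hπ
  have q₂ := proj r₂
  rw [copyMap_fst, copyMap_fst] at q₂
  by_cases hxy : π x = π y
  -- Both pieces are nonempty, so each projects to a closed walk of length at most `p`.
  · rw [hxy] at q₁ q₂
    rw [hH _ (by omega) _ _ q₁, hH _ (by omega) _ _ q₂, add_zero]
  have hadj : H.Adj (π x) (π y) := by
    rcases hu with hu | hu <;> rcases hy with hy | hy <;> rw [hu, hy] at hxy ⊢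
    · exact absurd rfl hxy
    · exact hab
    · exact hab.symm
    · exact absurd rfl hxy
  obtain ⟨m, z, w, n₃, c₃, n₄, c₄, hm, hyz, hw, r₃, r₄, rfl, rfl, hn₃⟩ :=
    exists_segment r₂ hn₂ (by rwa [copyMap_fst])
  have hyz' : π z = π y := by
    rw [← copyMap_fst (π := π) (l := m) (a := a) (b := b) z, ← hyz, copyMap_fst]
  have q₃ := r₃.project hπ
  have q₄ := proj r₄
  rw [copyMap_fst, copyMap_fst] at q₄
  rw [hyz'] at q₃
  rcases Nat.eq_zero_or_pos n₄ with rfl | hn₄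
  · obtain ⟨hwx, rfl⟩ := r₄.of_zero
    have hwx' : π w = π x := by
      rw [← copyMap_fst (π := π) (l := m) (a := a) (b := b) w, hwx, copyMap_fst]
    have induced : ∀ {l : ι → Option (X × X)} {s t : X}, IsEdgeLine P l → π s = π x → π t = π y →
        (amalgam P H π a b hπ ι).Adj (copyMap π a b l s) (copyMap π a b l t) → P.Adj s t := by
      intro l s t hl hs ht h
      rcases hu with hu | hu <;> rcases hy with hy | hy
      · exact absurd (hu.trans hy.symm) hxy
      · exact adj_of_amalgam_adj hab.ne hl (hs.trans hu) (ht.trans hy) h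
      · exact (adj_of_amalgam_adj hab.ne hl (ht.trans hy) (hs.trans hu) h.symm).symm
      · exact absurd (hu.trans hy.symm) hxy
    rw [hwx'] at q₃
    -- Two segments over the edge `ab`. If both have at least two steps, each plus that edge has
    -- length at most `p`. A one-step segment is instead an edge of the other segment's copy and
    -- closes it up inside `P`, where length `p + 1` is allowed.
    rcases Nat.lt_or_ge 1 n₁ with h1 | h1
    · rcases Nat.lt_or_ge 1 n₃ with h3 | h3
      · simpa using add_eq_zero_of_walks_over_edge hH hadj q₁ q₃ (by omega) (by omega)
      · obtain rfl : n₃ = 1 := by omega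
        obtain ⟨hzw, rfl⟩ := r₃.of_one
        have key : P.Adj x y := induced hl rfl rfl ⟨m, hm, w, z, hzw.symm, hwx, hyz.symm⟩
        have := hP _ (by omega) _ _ (r₁.trans (SignedReach.single key.symm))
        rw [hyz', hwx']
        linarith
    · obtain rfl : n₁ = 1 := by omega
      obtain ⟨hxy', rfl⟩ := r₁.of_one
      have key : P.Adj w z := induced hm hwx' hyz' ⟨l, hl, x, y, hxy', hwx.symm, hyz⟩
      have := hP _ (by omega) _ _ (r₃.trans (SignedReach.single key))
      rw [hyz', hwx'] at this
      linarith
  -- With a remainder left, the three pieces group into two nonempty closed walks in `H`.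
  · have hw' : π w = π x ∨ π w = π y := by
      rcases hu with hu | hu <;> rcases hy with hy | hy <;> rcases hw with hw | hw <;>
        simp_all
    rcases hw' with hw' | hw'
    · rw [hw'] at q₃ q₄
      have h1 := hH _ (by omega) _ _ (q₁.trans q₃)
      have h2 := hH _ (by omega) _ _ q₄
      linarith
    · rw [hw'] at q₃ q₄
      have h1 := hH _ (by omega) _ _ q₃
      have h2 := hH _ (by omega) _ _ (q₁.trans q₄)
      linarith

theorem balancedUpTo_amalgam (hab : H.Adj a b) {p : ℕ} (hH : BalancedUpTo p H id)
    (hP : BalancedUpTo (p + 1) P π) :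
    BalancedUpTo (p + 1) (amalgam P H π a b hπ ι) Prod.fst := by
  intro n hn c u h
  by_cases hu : u.1 = a ∨ u.1 = b
  · exact balance_of_closed_of_cut hab hH hP hn hu h
  push Not at hu
  have h0 := h
  cases h with
  | refl => rfl
  | step hadj hr =>
    obtain ⟨l, hl, x, y, hxy, rfl, rfl⟩ := hadj
    rw [copyMap_fst] at hu
    rcases lift_or_reach_cut h0 l x hl rfl hu.1 hu.2 with ⟨z, hz, hr'⟩ | ⟨z, n₁, c₁, n₂, c₂, hz, h1, h2, h3, h4, h5⟩
    · obtain rfl := copyMap_injective hl hz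
      exact hP _ hn _ _ hr'
    -- Rotate the closed walk to start above `a` or `b`.
    · have h1' : SignedReach (amalgam P H π a b hπ ι) Prod.fst n₁ c₁ (copyMap π a b l x)
          (copyMap π a b l z) :=
        h1.map (G' := amalgam P H π a b hπ ι) (copyMap π a b l) (fun s t hst => ⟨l, hl, s, t, hst, rfl, rfl⟩)
          (fun s t _ => by rw [copyMap_fst, copyMap_fst])
      rw [← h4, add_comm]
      exact balance_of_closed_of_cut hab hH hP (by omega) (by rwa [copyMap_fst]) (h2.trans h1')

end Amalgam

/-! ### The partite construction -/

universe u

theorem exists_amalgam {W : Type} [Finite W] [LinearOrder W] {H : SimpleGraph W} {p : ℕ}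
    (hH : BalancedUpTo p H id) {r : ℕ} (hr : 0 < r) (a b : W) {X : Type u} [Finite X] (P : SimpleGraph X)
    (π : X → W) (hπ : ∀ x y, P.Adj x y → H.Adj (π x) (π y)) (hP : BalancedUpTo (p + 1) P π) :
    ∃ (X' : Type u) (_ : Finite X') (P' : SimpleGraph X') (π' : X' → W),
      (∀ x y, P'.Adj x y → H.Adj (π' x) (π' y)) ∧ BalancedUpTo (p + 1) P' π' ∧
      ∀ χ : X' → X' → Fin r, ∃ g : X → X', (∀ x y, P.Adj x y → P'.Adj (g x) (g y)) ∧
        (∀ x, π' (g x) = π x) ∧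
        ∃ c, ∀ x y, P.Adj x y → π x = a → π y = b → χ (g x) (g y) = c := by
  by_cases hab : H.Adj a b
  swap
  · refine ⟨X, inferInstance, P, π, hπ, hP, fun χ => ⟨id, fun _ _ h => h, fun _ => rfl, ?_⟩⟩
    exact ⟨⟨0, hr⟩, fun x y h hx hy => absurd (hx ▸ hy ▸ hπ _ _ h) hab⟩
  obtain ⟨ι, _, hι⟩ := Combinatorics.Line.exists_mono_in_high_dimension
    {e : X × X // P.Adj e.1 e.2 ∧ π e.1 = a ∧ π e.2 = b} (Fin r)
  refine ⟨W × Option (ι → Option (X × X)) × (ι → X), inferInstance, amalgam P H π a b hπ ι,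
    Prod.fst, fun _ _ => amalgam_adj_fst, balancedUpTo_amalgam hab hH hP, fun χ => ?_⟩
  obtain ⟨L, c, hc⟩ := hι fun w => χ (a, none, fun i => (w i).1.1) (b, none, fun i => (w i).1.2)
  have hl : IsEdgeLine P fun i => (L.idxFun i).map Subtype.val := by
    refine ⟨L.proper.imp fun i hi => by simp [hi], fun i e he => ?_⟩
    obtain ⟨d, -, rfl⟩ := Option.map_eq_some_iff.1 he
    exact d.2.1
  refine ⟨copyMap π a b fun i => (L.idxFun i).map Subtype.val,
    fun x y h => ⟨_, hl, x, y, h, rfl, rfl⟩, copyMap_fst, c, fun x y h hx hy => ?_⟩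
  -- The copy of an edge above `(a, b)` is the point of the line `L` at that letter.
  rw [copyMap_of_left hx, copyMap_of_right hab.ne hy, ← hc ⟨(x, y), h, hx, hy⟩]
  congr 3 <;> funext i <;> cases hi : L.idxFun i <;> simp [hi]

theorem exists_partite {W : Type} [Finite W] [LinearOrder W] {H : SimpleGraph W} {p : ℕ}
    (hH : BalancedUpTo p H id) {r : ℕ} (hr : 0 < r) (L : List (W × W)) :
    ∀ {X : Type u} [Finite X] (P : SimpleGraph X)
    (π : X → W) (_ : ∀ x y, P.Adj x y → H.Adj (π x) (π y)) (_ : BalancedUpTo (p + 1) P π),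
    ∃ (X' : Type u) (_ : Finite X') (P' : SimpleGraph X') (π' : X' → W),
      (∀ x y, P'.Adj x y → H.Adj (π' x) (π' y)) ∧ BalancedUpTo (p + 1) P' π' ∧
      ∀ χ : X' → X' → Fin r, ∃ g : X → X', (∀ x y, P.Adj x y → P'.Adj (g x) (g y)) ∧
        (∀ x, π' (g x) = π x) ∧
        ∀ e ∈ L, ∃ c, ∀ x y, P.Adj x y → π x = e.1 → π y = e.2 → χ (g x) (g y) = c := by
  induction L with
  | nil =>
    intro X _ P π hπ hP
    exact ⟨X, inferInstance, P, π, hπ, hP, fun χ => ⟨id, by simp, by simp, by simp⟩⟩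
  | cons e L ih =>
    intro X _ P π hπ hP
    obtain ⟨X₁, _, P₁, π₁, hπ₁, hP₁, hr₁⟩ := exists_amalgam hH hr e.1 e.2 P π hπ hP
    obtain ⟨X₂, h₂, P₂, π₂, hπ₂, hP₂, hr₂⟩ := ih P₁ π₁ hπ₁ hP₁
    refine ⟨X₂, h₂, P₂, π₂, hπ₂, hP₂, fun χ => ?_⟩
    obtain ⟨g₂, ha₂, hg₂, hc₂⟩ := hr₂ χ
    obtain ⟨g₁, ha₁, hg₁, c, hc₁⟩ := hr₁ fun x y => χ (g₂ x) (g₂ y)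
    refine ⟨g₂ ∘ g₁, fun x y h => ha₂ _ _ (ha₁ _ _ h), fun x => (hg₂ _).trans (hg₁ x), ?_⟩
    intro d hd
    rcases List.mem_cons.1 hd with rfl | hd
    · exact ⟨c, hc₁⟩
    · obtain ⟨c', hc'⟩ := hc₂ d hd
      exact ⟨c', fun x y h hx hy => hc' _ _ (ha₁ _ _ h) ((hg₁ x).trans hx) ((hg₁ y).trans hy)⟩

/-- Every colouring of the pairs of vertices of `H` admits an order-preserving homomorphism from `G`
to `H` with monochromatic image. -/
def HomRamsey {V W : Type*} [LinearOrder V] [LinearOrder W]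
    (H : SimpleGraph W) (G : SimpleGraph V) (r : ℕ) : Prop :=
  ∀ χ : W → W → Fin r, ∃ φ : V → W, StrictMono φ ∧ (∀ u v, G.Adj u v → H.Adj (φ u) (φ v)) ∧
    ∃ c, ∀ u v, u < v → G.Adj u v → χ (φ u) (φ v) = c

/-! ### Ramsey's theorem for pairs -/

theorem ramsey_pairs_of_sum (r s : ℕ) (hr : 0 < r) : ∀ t : Fin r → ℕ, ∑ c, t c = s →
    ∃ N : ℕ, ∀ (S : Finset ℕ) (χ : ℕ → ℕ → Fin r), N ≤ S.card →
      ∃ c, ∃ T ⊆ S, T.card = t c ∧ ∀ x ∈ T, ∀ y ∈ T, x < y → χ x y = c := by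
  induction s with
  | zero =>
    intro t ht
    have := Finset.sum_eq_zero_iff.1 ht ⟨0, hr⟩ (Finset.mem_univ _)
    exact ⟨0, fun S χ _ => ⟨⟨0, hr⟩, ∅, by simp, by simp [this], by simp⟩⟩
  | succ s ih =>
    intro t ht
    by_cases h0 : ∃ c, t c = 0
    · obtain ⟨c, hc⟩ := h0
      exact ⟨0, fun S χ _ => ⟨c, ∅, by simp, by simp [hc], by simp⟩⟩
    push Not at h0
    have hsum : ∀ c, ∑ d, Function.update t c (t c - 1) d = s := by
      intro c
      have h1 := Finset.add_sum_erase Finset.univ t (Finset.mem_univ c)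
      have h2 := Finset.sum_update_of_mem (Finset.mem_univ c) t (t c - 1)
      rw [Finset.sdiff_singleton_eq_erase] at h2
      have := h0 c
      omega
    choose N hN using fun c => ih _ (hsum c)
    -- One for the minimum of `S`; the rest is for the pigeonhole on colours of pairs at it.
    refine ⟨1 + ∑ c, N c, fun S χ hS => ?_⟩
    have hne : S.Nonempty := Finset.card_pos.1 (by omega)
    set x := S.min' hne with hx
    have hxS : x ∈ S := Finset.min'_mem _ _
    have hcard := Finset.card_eq_sum_card_fiberwise (s := S.erase x) (t := Finset.univ) (f := χ x)
      (fun _ _ => by simp)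
    rw [Finset.card_erase_of_mem hxS] at hcard
    have : Nonempty (Fin r) := ⟨⟨0, hr⟩⟩
    obtain ⟨c, -, hc⟩ := Finset.exists_le_of_sum_le (s := (Finset.univ : Finset (Fin r)))
      (f := N) (g := fun c => ((S.erase x).filter fun y => χ x y = c).card)
      Finset.univ_nonempty (by omega)
    obtain ⟨d, T, hT, hTc, hTχ⟩ := hN c _ χ hc
    have hTS : T ⊆ S := fun y hy => Finset.mem_of_mem_erase (Finset.mem_filter.1 (hT hy)).1
    by_cases hdc : d = c
    · subst hdc
      have hxT : ∀ y ∈ T, x < y := fun y hy =>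
        lt_of_le_of_ne (Finset.min'_le _ _ (hTS hy))
          (Finset.ne_of_mem_erase (Finset.mem_filter.1 (hT hy)).1).symm
      refine ⟨d, insert x T, Finset.insert_subset hxS hTS, ?_, ?_⟩
      · rw [Finset.card_insert_of_notMem fun h => (hxT x h).false, hTc, Function.update_self]
        have := h0 d
        omega
      · intro y hy z hz hyz
        rcases Finset.mem_insert.1 hy with rfl | hy' <;> rcases Finset.mem_insert.1 hz with rfl | hz'
        · exact absurd hyz (lt_irrefl _)
        · exact (Finset.mem_filter.1 (hT hz')).2
        · exact absurd hyz (hxT y hy').not_gt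
        · exact hTχ y hy' z hz' hyz
    · exact ⟨d, T, hTS, by rwa [Function.update_of_ne hdc] at hTc, hTχ⟩

theorem exists_homRamsey_top (r : ℕ) (hr : 0 < r) {V : Type u} [Finite V] [LinearOrder V]
    (G : SimpleGraph V) : ∃ n : ℕ, HomRamsey (⊤ : SimpleGraph (Fin n)) G r := by
  have := Fintype.ofFinite V
  obtain ⟨N, hN⟩ := ramsey_pairs_of_sum r _ hr (fun _ => Fintype.card V) rfl
  refine ⟨N, fun χ => ?_⟩
  obtain ⟨c, T, hT, hTc, hTχ⟩ := hN (Finset.range N)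
    (fun x y => if h : x < N ∧ y < N then χ ⟨x, h.1⟩ ⟨y, h.2⟩ else ⟨0, hr⟩) (by simp)
  have e : V ≃o T := (Fintype.orderIsoFinOfCardEq V rfl).symm.trans (T.orderIsoOfFin hTc)
  have hlt : ∀ v, (e v : ℕ) < N := fun v => Finset.mem_range.1 (hT (e v).2)
  have hmono : StrictMono fun v => (⟨e v, hlt v⟩ : Fin N) := fun u v h => e.strictMono h
  refine ⟨fun v => ⟨e v, hlt v⟩, hmono, fun u v h => ?_, c, fun u v huv _ => ?_⟩
  · rw [top_adj]
    exact hmono.injective.ne h.ne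
  · have := hTχ _ (e u).2 _ (e v).2 (e.strictMono huv)
    rwa [dif_pos ⟨hlt u, hlt v⟩] at this

/-! ### The Ramsey theorem for locally balanced ordered graphs -/

theorem exists_fin_of_partite {W : Type} [LinearOrder W] {H : SimpleGraph W} {p : ℕ}
    {X : Type u} [Finite X] (P : SimpleGraph X) (π : X → W)
    (hπ : ∀ x y, P.Adj x y → H.Adj (π x) (π y)) (hP : BalancedUpTo p P π) :
    ∃ (n : ℕ) (e : X ≃ Fin n), (∀ x y, π x < π y → e x < e y) ∧
      BalancedUpTo p (P.comap e.symm) id := by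
  obtain ⟨k, ⟨e₀⟩⟩ := Finite.exists_equiv_fin X
  -- Ties within a fibre are harmless: adjacent vertices have distinct projections.
  let ord : LinearOrder X := LinearOrder.lift' (fun x => toLex (π x, e₀ x)) fun x y h =>
    e₀.injective (congrArg Prod.snd (toLex.injective h))
  have := Fintype.ofFinite X
  let e : X ≃o Fin (Fintype.card X) := (Fintype.orderIsoFinOfCardEq X rfl).symm
  have hmono : ∀ x y, π x < π y → e x < e y := fun x y h =>
    e.strictMono (Prod.Lex.toLex_lt_toLex.2 (Or.inl h))
  refine ⟨_, e.toEquiv, hmono, fun n hn b v h => hP n hn b (e.symm v) ?_⟩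
  refine h.map e.symm (fun _ _ h => h) fun i j hij => ⟨fun h => ?_, fun h => ?_⟩
  · simpa using hmono _ _ h
  · by_contra hlt
    have hne := (hπ _ _ hij).ne
    have := hmono _ _ (lt_of_le_of_ne (not_lt.1 hlt) hne.symm)
    simp only [OrderIso.apply_symm_apply] at this
    exact absurd h this.not_gt

theorem exists_homRamsey (r : ℕ) (hr : 0 < r) {V : Type u} [Finite V] [LinearOrder V]
    (G : SimpleGraph V) (p : ℕ) (hG : BalancedUpTo p G id) :
    ∃ (n : ℕ) (H : SimpleGraph (Fin n)), BalancedUpTo p H id ∧ HomRamsey H G r := by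
  induction p with
  | zero =>
    obtain ⟨n, hn⟩ := exists_homRamsey_top r hr G
    refine ⟨n, ⊤, fun m hm b v h => ?_, hn⟩
    obtain rfl : m = 0 := by omega
    exact h.of_zero.2
  | succ p ih =>
    obtain ⟨m, H, hH, hR⟩ := ih fun n hn => hG n (by omega)
    let P₀ : SimpleGraph (V × (V → Fin m)) :=
      { Adj := fun x y => x.2 = y.2 ∧ G.Adj x.1 y.1 ∧ StrictMono x.2 ∧
          ∀ u v, G.Adj u v → H.Adj (x.2 u) (x.2 v)
        symm := ⟨fun x y ⟨h1, h2, h3, h4⟩ => ⟨h1.symm, h2.symm, h1 ▸ h3, h1 ▸ h4⟩⟩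
        loopless := ⟨fun x h => G.irrefl h.2.1⟩ }
    let π₀ : V × (V → Fin m) → Fin m := fun x => x.2 x.1
    have hπ₀ : ∀ x y, P₀.Adj x y → H.Adj (π₀ x) (π₀ y) := by
      rintro ⟨u, φ⟩ ⟨v, ψ⟩ ⟨h1, h2, h3, h4⟩
      obtain rfl : φ = ψ := h1
      exact h4 _ _ h2
    have hP₀ : BalancedUpTo (p + 1) P₀ π₀ := by
      refine fun n hn b v h => hG n hn b v.1 (SignedReach.map (G := P₀) (G' := G) Prod.fst (fun x y h => h.2.1) ?_ h)
      rintro ⟨u, φ⟩ ⟨v, ψ⟩ ⟨h1, h2, h3, h4⟩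
      obtain rfl : φ = ψ := h1
      exact h3.lt_iff_lt.symm
    obtain ⟨X, _, P, π, hπ, hP, hχ⟩ := exists_partite hH hr Finset.univ.toList P₀ π₀ hπ₀ hP₀
    obtain ⟨n, e, he, hB⟩ := exists_fin_of_partite P π hπ hP
    refine ⟨n, _, hB, fun χ => ?_⟩
    obtain ⟨g, hg, hgπ, hc⟩ := hχ fun x y => χ (e x) (e y)
    choose c hc using fun d : Fin m × Fin m => hc d (by simp)
    obtain ⟨φ, hφ, hφH, k, hk⟩ := hR fun x y => c (x, y)
    refine ⟨fun v => e (g (v, φ)), fun u v huv => he _ _ ?_, fun u v huv => ?_, k,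
      fun u v huv hadj => ?_⟩
    · rw [hgπ, hgπ]
      exact hφ huv
    · simpa using hg (u, φ) (v, φ) ⟨rfl, huv, hφ, hφH⟩
    · rw [← hk u v huv hadj]
      exact hc (φ u, φ v) (u, φ) (v, φ) ⟨rfl, hadj, hφ, hφH⟩ rfl rfl

/-! ### From homomorphisms to monochromatic subgraphs -/

theorem HomRamsey.edgeRamsey {V W : Type*} [LinearOrder V] [LinearOrder W]
    {H : SimpleGraph W} {G : SimpleGraph V} {r : ℕ} (hr : 0 < r) (h : HomRamsey H G r) :
    EdgeRamsey H G r := by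
  classical
  intro χ
  obtain ⟨φ, hφ, hφH, c, hc⟩ :=
    h fun x y => if hxy : H.Adj x y then χ ⟨s(x, y), hxy⟩ else ⟨0, hr⟩
  let G' : H.Subgraph :=
    { verts := Set.range φ
      Adj := fun x y => ∃ u v, G.Adj u v ∧ φ u = x ∧ φ v = y
      adj_sub := by
        rintro x y ⟨u, v, huv, rfl, rfl⟩
        exact hφH u v huv
      edge_vert := by
        rintro x y ⟨u, v, huv, rfl, rfl⟩
        exact ⟨u, rfl⟩
      symm := ⟨fun x y ⟨u, v, huv, hu, hv⟩ => ⟨v, u, huv.symm, hv, hu⟩⟩ }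
  refine ⟨G', ⟨hφ.orderIso φ, fun u v => ⟨fun huv => ⟨u, v, huv, rfl, rfl⟩, ?_⟩⟩, c, ?_⟩
  · rintro ⟨u', v', huv, hu, hv⟩
    obtain rfl := hφ.injective hu
    obtain rfl := hφ.injective hv
    exact huv
  · rintro ⟨e, he⟩ he'
    induction e with | _ x y =>
    obtain ⟨u, v, huv, rfl, rfl⟩ := Subgraph.mem_edgeSet.1 he'
    rcases lt_or_gt_of_ne huv.ne with hlt | hlt
    · have := hc u v hlt huv
      rwa [dif_pos (hφH _ _ huv)] at this
    · have := hc v u hlt huv.symm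
      rw [dif_pos (hφH _ _ huv.symm)] at this
      rw [← this]
      congr 2
      exact Sym2.eq_swap

theorem mainTheorem3 (r p : ℕ) (hr : 0 < r) (hp : 0 < p)
    (V : Type*) [Finite V] [LinearOrder V] (G : SimpleGraph V) (hG : MemBal p G) :
    ∃ (n : ℕ) (H : SimpleGraph (Fin n)), MemBal p H ∧ EdgeRamsey H G r := by
  obtain ⟨n, H, hH, hR⟩ := exists_homRamsey r hr G p hG.balancedUpTo
  exact ⟨n, H, hH.memBal, hR.edgeRamsey hr⟩
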